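/- Let $n\ge 3$. For a permutation $\nu$ of $\{1,\dots,n\}$ let its degree (cyclic descent number) be $\deg(\nu)=\#\{\,i\in\{1,\dots,n\}:\nu(i)>\nu(i+1)\,\}$, where $i+1$ is taken modulo $n$ (so $\nu(n+1)=\nu(1)$). Let $N_{n,d}$ be the number of $n$-cycles $\nu$ in the symmetric group on $\{1,\dots,n\}$ with $\deg(\nu)=d$. For $k\ge 1$ put $$\Delta_n(k)=\sum_{r\mid n}\mu\Big(\frac nr\Big)\Big(\sum_{j=0}^{r-1}k^j\Big),$$ where $\mu$ is the Möbius function. Then the generating function $G_n(x)=\sum_{d=1}^{n-2}N_{n,d}\,x^d$ satisfies $$G_n(x)=(1-x)^n\sum_{i\ge 1}\Delta_n(i)\,x^i$$ as an equality of formal power series in $x$ with integer coefficients. Moreover, for every complex number $x$ with $|x|<1$ the series on the right converges absolutely and the equality holds numerically. -/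

import Mathlib

namespace CycleDegree

/-- The degree (cyclic descent number) of a permutation `ν` of `n` letters: the number of positions
`i`, taken modulo `n`, with `ν i > ν (i + 1)`. Here `finRotate n` is `i ↦ i + 1` modulo `n`. -/
def deg {n : ℕ} (ν : Equiv.Perm (Fin n)) : ℕ :=
  (Finset.univ.filter fun i : Fin n => ν (finRotate n i) < ν i).card

/-- The set of all `n`-cycles in the symmetric group on `n` letters. -/
def cycles (n : ℕ) : Set (Equiv.Perm (Fin n)) :=
  {ν | ν.IsCycle ∧ ν.support = Finset.univ}

/-- `N n d` is the number of `n`-cycles of degree `d`. -/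
noncomputable def N (n d : ℕ) : ℕ :=
  {ν : Equiv.Perm (Fin n) | ν ∈ cycles n ∧ deg ν = d}.ncard

/-- `Δ_n(k) = ∑_{r ∣ n} μ(n / r) (1 + k + ⋯ + k^(r-1))`. -/
def Delta (n k : ℕ) : ℤ :=
  ∑ r ∈ n.divisors, ArithmeticFunction.moebius (n / r) * ∑ j ∈ Finset.range r, (k : ℤ) ^ j

/-- The generating function `G_n(x) = ∑_{d=1}^{n-2} N_{n,d} x^d`, a polynomial. -/
noncomputable def G (n : ℕ) : Polynomial ℤ :=
  ∑ d ∈ Finset.Icc 1 (n - 2), Polynomial.C (N n d : ℤ) * Polynomial.X ^ d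

/-- The formal power series `∑_{i ≥ 1} Δ_n(i) x^i`. -/
noncomputable def DeltaSeries (n : ℕ) : PowerSeries ℤ :=
  PowerSeries.mk fun i => if 1 ≤ i then Delta n i else 0

end CycleDegree

/-! Write n = m + 1. Everything follows from the identity Δ_n(k) = ∑ C(k + m - deg ν, m), summed
over the n-cycles ν (`Delta_eq_sum`), because ∑_k C(k + m - d, m) x^k = x^d / (1 - x)^n.

The identity counts primitive words of length n over k letters in two ways. Möbius inversion over
periods gives ∑ μ(n/r) k^r = (k - 1) Δ_n(k). On the other hand, let e rank the cyclic shifts of a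
primitive word lexicographically. The word is then recorded by the n-cycle ν that sends the rank of
each shift to the rank of the next one, and by the sorted first letters c; such pairs are exactly
those with (c i, ν i) lexicographically increasing (`primitiveCount_eq_sum`). For fixed ν the number
of such c is a binomial coefficient in the linear descent number (`lexCount_eq`). Summing over the
conjugates of ν by rotations replaces linear descents by the degree and produces the factor k - 1
(`sum_lexCount_rotConj`). -/

namespace CycleDegree

/-! ### Degree as total rotation; its bounds on n-cycles -/

theorem val_sub_add_val {m : ℕ} (x y : Fin (m + 1)) :
    (x - y).val + y.val = x.val + if x < y then m + 1 else 0 := by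
  have hx := x.isLt
  have hy := y.isLt
  rw [Fin.sub_def]
  simp only [Fin.lt_def]
  split_ifs with h
  · rw [Nat.mod_eq_of_lt (by omega)]; omega
  · have : m + 1 - y.val + x.val = (x.val - y.val) + (m + 1) := by omega
    rw [this, Nat.add_mod_right, Nat.mod_eq_of_lt (by omega)]; omega

theorem sum_comp_add_one {m : ℕ} (f : Fin (m + 1) → ℕ) : ∑ i, f (i + 1) = ∑ i, f i :=
  Equiv.sum_comp (Equiv.addRight (1 : Fin (m + 1))) f

/-- The total rotation of the cyclic sequence `ν 0, ν 1, …` is its degree. -/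
theorem mul_deg_eq_sum {m : ℕ} (ν : Equiv.Perm (Fin (m + 1))) :
    (m + 1) * deg ν = ∑ i, (ν (i + 1) - ν i).val := by
  have h := Finset.sum_congr (rfl : (Finset.univ : Finset (Fin (m + 1))) = _)
    fun i _ => val_sub_add_val (ν (i + 1)) (ν i)
  rw [Finset.sum_add_distrib, Finset.sum_add_distrib,
    sum_comp_add_one fun i => (ν i).val] at h
  have h2 : ∑ i, (if ν (i + 1) < ν i then m + 1 else 0) = (m + 1) * deg ν := by
    simp [deg, Finset.sum_ite, mul_comm]
  omega

/-- The conjugate of `ν` by the rotation by `j`. -/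
def rotConj {m : ℕ} (j : Fin (m + 1)) (ν : Equiv.Perm (Fin (m + 1))) :
    Equiv.Perm (Fin (m + 1)) :=
  Equiv.subRight j * ν * (Equiv.subRight j)⁻¹

theorem rotConj_apply {m : ℕ} (j : Fin (m + 1)) (ν : Equiv.Perm (Fin (m + 1)))
    (i : Fin (m + 1)) : rotConj j ν i = ν (i + j) - j := rfl

theorem deg_rotConj {m : ℕ} (j : Fin (m + 1)) (ν : Equiv.Perm (Fin (m + 1))) :
    deg (rotConj j ν) = deg ν := by
  apply Nat.eq_of_mul_eq_mul_left (Nat.succ_pos m)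
  rw [Nat.succ_eq_add_one, mul_deg_eq_sum, mul_deg_eq_sum,
    ← Equiv.sum_comp (Equiv.addRight j) fun i => (ν (i + 1) - ν i).val]
  refine Finset.sum_congr rfl fun i _ => ?_
  simp only [rotConj_apply, Equiv.coe_addRight]
  congr 1
  rw [add_right_comm]
  abel

/-- For a permutation without fixed points, the number of rotations of it that have a descent from
the last to the first position is one less than the degree. -/
theorem card_wrap_add_one {m : ℕ} (ν : Equiv.Perm (Fin (m + 1))) (hν : ∀ i, ν i ≠ i) :
    (Finset.univ.filter fun j => rotConj j ν 0 < rotConj j ν (Fin.last m)).card + 1 = deg ν := by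
  -- Summed over i, the displacement terms `ν i - i` cancel, leaving n · deg ν = n + n · #wraps.
  -- Having no fixed points ensures that `ν i - i - 1` does not wrap around.
  have key : ∀ i : Fin (m + 1), (ν (i + 1) - ν i).val + (ν i - i).val =
      (ν (i + 1) - (i + 1)).val + 1 +
        if rotConj (i + 1) ν 0 < rotConj (i + 1) ν (Fin.last m) then m + 1 else 0 := by
    intro i
    have h := val_sub_add_val (rotConj (i + 1) ν 0) (rotConj (i + 1) ν (Fin.last m))
    have e0 : rotConj (i + 1) ν 0 = ν (i + 1) - (i + 1) := by simp [rotConj_apply]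
    have e1 : rotConj (i + 1) ν (Fin.last m) = ν i - i - 1 := by
      have : Fin.last m + (i + 1) = i := by
        rw [add_comm i, ← add_assoc, Fin.last_add_one, zero_add]
      rw [rotConj_apply, this]; abel
    have e2 : (ν i - i - 1).val + 1 = (ν i - i).val := by
      have h0 : ν i - i ≠ 0 := sub_ne_zero.2 (hν i)
      have := Fin.val_sub_one_of_ne_zero h0
      have := Fin.pos_iff_ne_zero.2 h0
      rw [Fin.lt_def] at this
      simp at this
      omega
    have e3 : rotConj (i + 1) ν 0 - rotConj (i + 1) ν (Fin.last m) = ν (i + 1) - ν i := by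
      rw [e0, e1]; abel
    rw [e3] at h
    rw [← e2, ← e0, ← e1]
    omega
  have h := Finset.sum_congr (rfl : (Finset.univ : Finset (Fin (m + 1))) = _) fun i _ => key i
  rw [Finset.sum_add_distrib, Finset.sum_add_distrib, Finset.sum_add_distrib, ← mul_deg_eq_sum,
    sum_comp_add_one fun i => (ν i - i).val,
    sum_comp_add_one fun j => if rotConj j ν 0 < rotConj j ν (Fin.last m) then m + 1 else 0] at h
  simp only [Finset.sum_ite, Finset.sum_const, Finset.card_univ, Fintype.card_fin, smul_eq_mul,
    mul_zero, add_zero, mul_one] at h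
  apply Nat.eq_of_mul_eq_mul_left (Nat.succ_pos m)
  rw [Nat.succ_eq_add_one]
  nlinarith

theorem ne_self_of_mem_cycles {n : ℕ} {ν : Equiv.Perm (Fin n)} (h : ν ∈ cycles n) (i : Fin n) :
    ν i ≠ i := Equiv.Perm.mem_support.1 (h.2 ▸ Finset.mem_univ i)

theorem deg_pos {n : ℕ} (hn : 0 < n) {ν : Equiv.Perm (Fin n)} (h : ν ∈ cycles n) :
    1 ≤ deg ν := by
  obtain ⟨m, rfl⟩ := Nat.exists_eq_succ_of_ne_zero hn.ne'
  rw [← card_wrap_add_one ν (ne_self_of_mem_cycles h)]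
  omega

/-- Degree at least n - 1 forces every cyclic step to equal -1, so ν is a reflection i ↦ ν 0 - i;
its order divides 2, which is impossible for an n-cycle with n ≥ 3. -/
theorem deg_le {n : ℕ} (hn : 3 ≤ n) {ν : Equiv.Perm (Fin n)} (h : ν ∈ cycles n) :
    deg ν ≤ n - 2 := by
  obtain ⟨m, rfl⟩ : ∃ m, n = m + 1 := ⟨n - 1, by omega⟩
  by_contra! hd
  have hs := mul_deg_eq_sum ν
  have hle : ∀ i ∈ (Finset.univ : Finset (Fin (m + 1))), (ν (i + 1) - ν i).val ≤ m :=
    fun i _ => Nat.lt_succ_iff.1 (ν (i + 1) - ν i).isLt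
  have hall := (Finset.sum_eq_sum_iff_of_le hle).1 (by
    apply le_antisymm (Finset.sum_le_sum hle)
    rw [← hs]
    simpa using Nat.mul_le_mul_left (m + 1) (show m ≤ deg ν by omega))
  have hstep : ∀ i, ν (i + 1) = ν i - 1 := by
    intro i
    have h1 : ν (i + 1) - ν i = Fin.last m := Fin.ext (hall i (Finset.mem_univ i))
    have h2 : ν (i + 1) - ν i + 1 = 0 := by rw [h1, Fin.last_add_one]
    rw [eq_sub_iff_add_eq, ← sub_eq_zero, ← h2]; abel
  have hlin : ∀ i, ν i = ν 0 - i := by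
    intro i
    induction i using Fin.induction with
    | zero => simp
    | succ i ih => rw [← Fin.coeSucc_eq_succ, hstep, ih]; abel
  have hsq : ν ^ 2 = 1 := by
    ext i
    rw [sq, Equiv.Perm.mul_apply, hlin (ν i), hlin i]
    simp
  have ho := h.1.orderOf
  rw [h.2, Finset.card_univ, Fintype.card_fin] at ho
  have := Nat.le_of_dvd two_pos (orderOf_dvd_of_pow_eq_one hsq)
  omega

/-! ### Counting lexicographically increasing sequences -/

theorem card_orderEmb (n k : ℕ) : Nat.card (Fin n ↪o Fin k) = k.choose n := by
  rw [Nat.card_congr Set.powersetCard.ofFinEmbEquiv, Set.powersetCard.card, Nat.card_eq_fintype_card,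
    Fintype.card_fin]

theorem add_le_of_strictMono {n k : ℕ} (e : Fin n ↪o Fin k) (i : Fin n) : i.val ≤ (e i).val := by
  obtain ⟨i, hi⟩ := i
  induction i with
  | zero => exact Nat.zero_le _
  | succ i ih =>
    have h1 := ih (by omega)
    have h2 : e ⟨i, by omega⟩ < e ⟨i + 1, hi⟩ := e.strictMono (by simp [Fin.lt_def])
    rw [Fin.lt_def] at h2
    simp only at h1 ⊢
    omega

/-- Adding partial sums of `δ` turns sequences that may fail to increase strictly only where `δ`
is positive into strictly increasing ones. -/
theorem card_lt_add {m k : ℕ} (δ : ℕ → ℕ) (hδ : ∀ i, δ i ≤ 1) :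
    Nat.card {c : Fin (m + 1) → Fin k // ∀ i : Fin m, (c i.castSucc).val < (c i.succ).val + δ i} =
      (k + ∑ j ∈ Finset.range m, δ j).choose (m + 1) := by
  have hmono : Monotone fun i => ∑ j ∈ Finset.range i, δ j :=
    monotone_nat_of_le_succ fun i => by simp [Finset.sum_range_succ]
  have hle : ∀ i, ∑ j ∈ Finset.range i, δ j ≤ i := fun i => by
    simpa using Finset.sum_le_sum fun j (_ : j ∈ Finset.range i) => hδ j
  have htop : ∀ i : Fin (m + 1), ∑ j ∈ Finset.range i.val, δ j ≤ ∑ j ∈ Finset.range m, δ j :=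
    fun i => hmono (Nat.lt_succ_iff.1 i.isLt)
  rw [← card_orderEmb]
  refine Nat.card_congr
    { toFun := fun c => OrderEmbedding.ofStrictMono
        (fun i => ⟨(c.1 i).val + ∑ j ∈ Finset.range i.val, δ j, by
          have := (c.1 i).isLt; have := htop i; omega⟩)
        (Fin.strictMono_iff_lt_succ.2 fun i => by
          have := c.2 i
          simp only [Fin.lt_def, Fin.val_castSucc, Fin.val_succ, Finset.sum_range_succ]
          omega)
      -- The subtraction never truncates: the partial sum is at most i, and i ≤ e i.
      invFun := fun e => ⟨fun i => ⟨(e i).val - ∑ j ∈ Finset.range i.val, δ j, by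
          have hm : Monotone fun i : Fin (m + 1) =>
              (e i).val - ∑ j ∈ Finset.range i.val, δ j :=
            Fin.monotone_iff_le_succ.2 fun i => by
              have h := e.strictMono (Fin.castSucc_lt_succ (i := i))
              have := hδ i.val
              simp only [Fin.lt_def, Fin.val_castSucc, Fin.val_succ, Finset.sum_range_succ] at *
              omega
          have h1 := hm (Fin.le_last i)
          have h2 := (e (Fin.last m)).isLt
          have h3 := add_le_of_strictMono e (Fin.last m)
          have h4 := hle m
          simp only [Fin.val_last] at h1 h3
          omega⟩, fun i => by
          have h := e.strictMono (Fin.castSucc_lt_succ (i := i))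
          have h1 := add_le_of_strictMono e i.castSucc
          have h2 := add_le_of_strictMono e i.succ
          have h3 := hle i.castSucc
          have h4 := hle i.succ
          simp only [Fin.lt_def, Fin.val_castSucc, Fin.val_succ, Finset.sum_range_succ] at *
          omega⟩
      left_inv := fun c => by
        ext i; simp
      right_inv := fun e => by
        ext i
        have h1 := add_le_of_strictMono e i
        have h2 := hle i
        simp
        omega }

/-- The number of sequences `c` for which `i ↦ (c i, ν i)` is lexicographically increasing. -/
noncomputable def lexCount {n : ℕ} (ν : Equiv.Perm (Fin n)) (k : ℕ) : ℕ :=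
  Nat.card {c : Fin n → Fin k // StrictMono fun i => toLex (c i, ν i)}

/-- The number of descents of a sequence, the cyclic one from the last to the first place not
included. -/
def linDes {m : ℕ} (ν : Equiv.Perm (Fin (m + 1))) : ℕ :=
  (Finset.univ.filter fun i : Fin m => ν i.succ < ν i.castSucc).card

theorem deg_eq_linDes_add {m : ℕ} (ν : Equiv.Perm (Fin (m + 1))) :
    deg ν = linDes ν + if ν 0 < ν (Fin.last m) then 1 else 0 := by
  simp only [deg, linDes, Finset.card_filter, Fin.sum_univ_castSucc, finRotate_apply,
    Fin.last_add_one, Fin.coeSucc_eq_succ]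

theorem lexCount_eq {m : ℕ} (ν : Equiv.Perm (Fin (m + 1))) (k : ℕ) :
    lexCount ν k = (k + m - linDes ν).choose (m + 1) := by
  -- δ marks the ascents of ν, the places where c may stay constant.
  set δ : ℕ → ℕ := fun i => if h : i < m then
    (if ν (⟨i, h⟩ : Fin m).castSucc < ν (⟨i, h⟩ : Fin m).succ then 1 else 0) else 0 with hδdef
  have hδ : ∀ i, δ i ≤ 1 := fun i => by simp only [hδdef]; split_ifs <;> omega
  have hδi : ∀ i : Fin m, δ i = if ν i.castSucc < ν i.succ then 1 else 0 := fun i => by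
    simp only [hδdef, i.isLt, dif_pos]
  have hsum : ∑ j ∈ Finset.range m, δ j + linDes ν = m := by
    rw [Finset.sum_range, linDes, Finset.card_filter, ← Finset.sum_add_distrib]
    trans ∑ i : Fin m, 1
    · refine Finset.sum_congr rfl fun i _ => ?_
      rw [hδi]
      have hne : ν i.castSucc ≠ ν i.succ := ν.injective.ne (Fin.castSucc_lt_succ (i := i)).ne
      rcases lt_or_gt_of_ne hne with h | h
      · simp [h, h.not_gt]
      · simp [h, h.not_gt]
    · simp
  have hk : k + m - linDes ν = k + ∑ j ∈ Finset.range m, δ j := by omega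
  rw [hk, ← card_lt_add δ hδ, lexCount]
  refine Nat.card_congr (Equiv.subtypeEquivRight fun c => ?_)
  rw [Fin.strictMono_iff_lt_succ]
  refine forall_congr' fun i => ?_
  rw [Prod.Lex.toLex_lt_toLex, hδi]
  simp only [Fin.ext_iff, Fin.lt_def]
  split_ifs <;> omega

/-- Of the m + 1 rotations, d - 1 have a wrap-around descent and m + 2 - d do not. Pascal's rule and
(m + 1) C(t, m + 1) = (t - m) C(t, m) combine their counts; for t < m everything vanishes. -/
theorem choose_combination {m k d : ℕ} (hd : 1 ≤ d) (hdm : d ≤ m) (hk : 1 ≤ k) :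
    (d - 1) * (k + m + 1 - d).choose (m + 1) + (m + 2 - d) * (k + m - d).choose (m + 1) =
      (k - 1) * (k + m - d).choose m := by
  obtain ⟨d, rfl⟩ := Nat.exists_eq_add_of_le' hd
  have h1 : k + m + 1 - (d + 1) = (k + m - (d + 1)) + 1 := by omega
  have h2 := Nat.choose_succ_right_eq (k + m - (d + 1)) m
  rw [h1, Nat.choose_succ_succ]
  set t := k + m - (d + 1) with ht
  by_cases htm : t < m
  · rw [Nat.choose_eq_zero_of_lt htm, Nat.choose_eq_zero_of_lt (by omega)]; simp
  · have h3 : t - m + d = k - 1 := by omega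
    have h4 : m + 2 - (d + 1) + d = m + 1 := by omega
    rw [← h3, Nat.add_sub_cancel]
    nlinarith

/-- The rotations of `ν` have `k - 1` times as many increasing sequences as `ν` has cyclic ones. -/
theorem sum_lexCount_rotConj {m k : ℕ} (hk : 1 ≤ k) (ν : Equiv.Perm (Fin (m + 1)))
    (hν : ∀ i, ν i ≠ i) (hd : deg ν ≤ m) :
    ∑ j, lexCount (rotConj j ν) k = (k - 1) * (k + m - deg ν).choose m := by
  have hw := card_wrap_add_one ν hν
  have hc := Finset.card_filter_add_card_filter_not
    (s := (Finset.univ : Finset (Fin (m + 1))))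
    fun j => rotConj j ν 0 < rotConj j ν (Fin.last m)
  have hterm : ∀ j, lexCount (rotConj j ν) k =
      if rotConj j ν 0 < rotConj j ν (Fin.last m) then (k + m + 1 - deg ν).choose (m + 1)
      else (k + m - deg ν).choose (m + 1) := by
    intro j
    have h := deg_eq_linDes_add (rotConj j ν)
    rw [deg_rotConj] at h
    rw [lexCount_eq]
    split_ifs at h ⊢ with hlt
    · congr 1; omega
    · congr 1; omega
  rw [Finset.sum_congr rfl fun j _ => hterm j, Finset.sum_ite, Finset.sum_const, Finset.sum_const,
    smul_eq_mul, smul_eq_mul, ← choose_combination (by omega) hd hk]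
  rw [Finset.card_univ, Fintype.card_fin] at hc
  congr 2 <;> omega

/-! ### Primitive words and the ranking of their shifts -/

/-- The cyclic shift of a word by `i` places, as an element of the lexicographic order. -/
def shiftWord {m k : ℕ} (w : Fin (m + 1) → Fin k) (i : Fin (m + 1)) :
    Lex (Fin (m + 1) → Fin k) :=
  toLex fun j => w (i + j)

/-- Comparing two shifts amounts to comparing first letters and, on a tie, the next shifts.
Unrolling this local rule up to the first differing letter gives the full comparison. -/
theorem strictMono_lex_iff_shiftWord {m k : ℕ} (e : Equiv.Perm (Fin (m + 1)))
    (w : Fin (m + 1) → Fin k) :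
    (StrictMono fun i => toLex (w (e.symm i), e (e.symm i + 1))) ↔
      StrictMono fun i => shiftWord w (e.symm i) := by
  have hL : (StrictMono fun i => toLex (w (e.symm i), e (e.symm i + 1))) ↔
      ∀ x y, e x < e y → w x < w y ∨ (w x = w y ∧ e (x + 1) < e (y + 1)) := by
    constructor
    · intro h x y hxy
      simpa [Prod.Lex.toLex_lt_toLex] using h hxy
    · intro h a b hab
      rw [Prod.Lex.toLex_lt_toLex]
      exact h _ _ (by simpa using hab)
  have hR : (StrictMono fun i => shiftWord w (e.symm i)) ↔
      ∀ x y, e x < e y → shiftWord w x < shiftWord w y := by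
    constructor
    · intro h x y hxy
      have := h hxy
      simp only [Equiv.symm_apply_apply] at this
      exact this
    · intro h a b hab
      exact h _ _ (by simpa using hab)
  rw [hL, hR]
  constructor
  · intro h x y hxy
    by_cases hall : ∀ j, w (x + j) = w (y + j)
    · exfalso
      have hlt : ∀ j, e (x + j) < e (y + j) := by
        intro j
        induction j using Fin.induction with
        | zero => simpa using hxy
        | succ j ih =>
          rw [← Fin.coeSucc_eq_succ, ← add_assoc, ← add_assoc]
          rcases h _ _ ih with h1 | h1
          · exact absurd (hall _) h1.ne
          · exact h1.2
      -- If the shifts agreed everywhere, the strict inequality of ranks would propagate around the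
      -- cycle to the element of top rank.
      have := hlt (e.symm (Fin.last m) - x)
      rw [add_sub_cancel, Equiv.apply_symm_apply] at this
      exact absurd (Fin.le_last _) this.not_ge
    · push Not at hall
      obtain ⟨j, hj, hmin⟩ := WellFounded.has_min (wellFounded_lt (α := Fin (m + 1)))
        {j | w (x + j) ≠ w (y + j)} hall
      have heq : ∀ i, i < j → w (x + i) = w (y + i) := fun i hi => by
        by_contra hne
        exact hmin i hne hi
      have hlt : ∀ i, i ≤ j → e (x + i) < e (y + i) := by
        intro i
        induction i using Fin.induction with
        | zero => intro; simpa using hxy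
        | succ i ih =>
          intro hij
          have hi : i.castSucc < j := lt_of_lt_of_le Fin.castSucc_lt_succ hij
          rw [← Fin.coeSucc_eq_succ, ← add_assoc, ← add_assoc]
          rcases h _ _ (ih hi.le) with h1 | h1
          · exact absurd (heq _ hi) h1.ne
          · exact h1.2
      refine ⟨j, heq, ?_⟩
      rcases h _ _ (hlt j le_rfl) with h1 | h1
      · exact h1
      · exact absurd h1.1 hj
  · intro h x y hxy
    obtain ⟨j, heq, hj⟩ := h x y hxy
    change ∀ i, i < j → w (x + i) = w (y + i) at heq
    change w (x + j) < w (y + j) at hj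
    induction j using Fin.cases with
    | zero => left; simpa using hj
    | succ j =>
      right
      refine ⟨by simpa using heq 0 (Fin.succ_pos j), ?_⟩
      by_contra hnot
      have hne : e (y + 1) ≠ e (x + 1) := fun hh => hxy.ne
        (congrArg e (add_right_cancel (e.injective hh))).symm
      have h3 := h _ _ (lt_of_le_of_ne (not_lt.1 hnot) hne)
      refine absurd h3 (not_lt_of_gt ⟨j.castSucc, fun i hi => ?_, ?_⟩)
      · change w (x + 1 + i) = w (y + 1 + i)
        have hil : i.val < m := lt_trans (Fin.lt_def.1 hi) j.isLt
        have := heq (i + 1) (by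
          have : i + 1 = (⟨i.val, hil⟩ : Fin m).succ := by
            rw [← Fin.coeSucc_eq_succ]; rfl
          rw [this, Fin.succ_lt_succ_iff]
          exact hi)
        rwa [add_comm i, ← add_assoc, ← add_assoc] at this
      · change w (x + 1 + j.castSucc) < w (y + 1 + j.castSucc)
        rwa [← Fin.coeSucc_eq_succ, add_comm _ (1 : Fin (m + 1)), ← add_assoc, ← add_assoc] at hj

/-- The number of words of length `m + 1` whose cyclic shifts are pairwise different. -/
noncomputable def primitiveCount (m k : ℕ) : ℕ :=
  Nat.card {w : Fin (m + 1) → Fin k // Function.Injective (shiftWord w)}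

theorem existsUnique_strictMono_symm {n : ℕ} {α : Type*} [LinearOrder α] {f : Fin n → α}
    (hf : Function.Injective f) : ∃! e : Equiv.Perm (Fin n), StrictMono fun i => f (e.symm i) := by
  refine ⟨(Tuple.sort f).symm, ?_, fun e he => ?_⟩
  · exact (Tuple.monotone_sort f).strictMono_of_injective (hf.comp (Tuple.sort f).injective)
  · have h := Tuple.unique_monotone (f := f) (σ := e.symm) (τ := Tuple.sort f) he.monotone
      (Tuple.monotone_sort f)
    have h2 : e.symm = Tuple.sort f := Equiv.ext fun i => hf (congrFun h i)
    rw [← h2, Equiv.symm_symm]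

theorem primitiveCount_eq_sum (m k : ℕ) :
    primitiveCount m k =
      ∑ e : Equiv.Perm (Fin (m + 1)), lexCount (e * finRotate (m + 1) * e⁻¹) k := by
  classical
  have h1 : ∀ e : Equiv.Perm (Fin (m + 1)), lexCount (e * finRotate (m + 1) * e⁻¹) k =
      Fintype.card {w : Fin (m + 1) → Fin k // StrictMono fun i => shiftWord w (e.symm i)} := by
    intro e
    rw [lexCount, ← Nat.card_eq_fintype_card]
    refine Nat.card_congr (Equiv.subtypeEquiv (Equiv.arrowCongr e.symm (Equiv.refl _)) fun c => ?_)
    rw [← strictMono_lex_iff_shiftWord]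
    simp [Equiv.Perm.mul_apply, ← Equiv.Perm.inv_def]
  rw [Finset.sum_congr rfl fun e _ => h1 e, ← Fintype.card_sigma, ← Nat.card_eq_fintype_card]
  symm
  refine Nat.card_congr (Equiv.ofBijective (fun p => ⟨p.2.1, ?_⟩) ⟨?_, ?_⟩)
  · have := p.2.2.injective.comp p.1.injective
    simpa [Function.comp_def] using this
  · rintro ⟨e, w, hw⟩ ⟨e', w', hw'⟩ h
    obtain rfl : w = w' := congrArg Subtype.val h
    have hinj : Function.Injective (shiftWord w) := by
      simpa [Function.comp_def] using hw.injective.comp e.injective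
    obtain rfl := (existsUnique_strictMono_symm hinj).unique hw hw'
    rfl
  · rintro ⟨w, hw⟩
    obtain ⟨e, he, -⟩ := existsUnique_strictMono_symm hw
    exact ⟨⟨e, w, he⟩, rfl⟩

/-! ### From rankings to n-cycles -/

theorem conj_finRotate_mem_cycles {n : ℕ} (hn : 2 ≤ n) (e : Equiv.Perm (Fin n)) :
    e * finRotate n * e⁻¹ ∈ cycles n := by
  refine ⟨(isCycle_finRotate_of_le hn).conj, ?_⟩
  rw [Equiv.Perm.support_conj, support_finRotate_of_le hn]
  exact Finset.map_univ_equiv e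

/-- Such an e is determined by `e 0`, and precomposing it with rotations makes that value arbitrary.
-/
theorem card_conj_fiber {m : ℕ} (hm : 1 ≤ m) {ν : Equiv.Perm (Fin (m + 1))}
    (hν : ν ∈ cycles (m + 1)) :
    Nat.card {e : Equiv.Perm (Fin (m + 1)) // e * finRotate (m + 1) * e⁻¹ = ν} = m + 1 := by
  have hiff : ∀ e : Equiv.Perm (Fin (m + 1)),
      e * finRotate (m + 1) * e⁻¹ = ν ↔ ∀ i, e (i + 1) = ν (e i) := by
    intro e
    rw [mul_inv_eq_iff_eq_mul, Equiv.ext_iff]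
    simp
  refine (Nat.card_congr (Equiv.ofBijective (fun e => e.1 0) ⟨?_, ?_⟩)).trans
    (Nat.card_fin (m + 1))
  · rintro ⟨e, he⟩ ⟨e', he'⟩ h
    rw [hiff] at he he'
    apply Subtype.ext
    ext1 i
    change e 0 = e' 0 at h
    change e i = e' i
    induction i using Fin.induction with
    | zero => exact h
    | succ i ih => rw [← Fin.coeSucc_eq_succ, he, he', ih]
  · intro p
    obtain ⟨e, he⟩ := isConj_iff.1 ((isCycle_finRotate_of_le (n := m + 1) (by omega)).isConj hν.1
      (by rw [support_finRotate_of_le (by omega), hν.2]))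
    rw [hiff] at he
    refine ⟨⟨Equiv.addRight (e.symm p) |>.trans e, ?_⟩, ?_⟩
    · rw [hiff]
      intro i
      simp only [Equiv.trans_apply, Equiv.coe_addRight]
      rw [← he, add_right_comm]
    · simp

open Classical in
theorem sum_conj_finRotate {m : ℕ} (hm : 1 ≤ m) (F : Equiv.Perm (Fin (m + 1)) → ℕ) :
    ∑ e : Equiv.Perm (Fin (m + 1)), F (e * finRotate (m + 1) * e⁻¹) =
      (m + 1) * ∑ ν with ν ∈ cycles (m + 1), F ν := by
  rw [← Finset.sum_fiberwise_of_maps_to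
    (g := fun e : Equiv.Perm (Fin (m + 1)) => e * finRotate (m + 1) * e⁻¹)
    (t := Finset.univ.filter fun ν => ν ∈ cycles (m + 1))
    (fun e _ => by simpa using conj_finRotate_mem_cycles (by omega) e), Finset.mul_sum]
  refine Finset.sum_congr rfl fun ν hν => ?_
  have hc := card_conj_fiber hm (Finset.mem_filter.1 hν).2
  rw [Nat.card_eq_fintype_card, Fintype.card_subtype] at hc
  rw [Finset.sum_congr rfl (g := fun _ => F ν) fun e he => by rw [(Finset.mem_filter.1 he).2],
    Finset.sum_const, hc, smul_eq_mul]

open Classical in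
theorem primitiveCount_eq_sum_cycles {m k : ℕ} (hm : 2 ≤ m) (hk : 1 ≤ k) :
    primitiveCount m k =
      (k - 1) * ∑ ν with ν ∈ cycles (m + 1), (k + m - deg ν).choose m := by
  apply Nat.eq_of_mul_eq_mul_left (Nat.succ_pos m)
  -- Left multiplication of e by a rotation permutes the summands, so the count can be averaged over
  -- all j.
  have hrot : ∀ j : Fin (m + 1), primitiveCount m k = ∑ e : Equiv.Perm (Fin (m + 1)),
      lexCount (rotConj j (e * finRotate (m + 1) * e⁻¹)) k := by
    intro j
    rw [primitiveCount_eq_sum, ← Equiv.sum_comp (Equiv.mulLeft (Equiv.subRight j))]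
    refine Finset.sum_congr rfl fun e _ => ?_
    congr 1
  have h1 : (m + 1) * primitiveCount m k = ∑ e : Equiv.Perm (Fin (m + 1)),
      (k - 1) * (k + m - deg (e * finRotate (m + 1) * e⁻¹)).choose m := by
    trans ∑ j : Fin (m + 1), primitiveCount m k
    · simp
    · rw [Finset.sum_congr rfl fun j _ => hrot j, Finset.sum_comm]
      refine Finset.sum_congr rfl fun e _ => ?_
      have hc := conj_finRotate_mem_cycles (n := m + 1) (by omega) e
      have := deg_le (by omega) hc
      exact sum_lexCount_rotConj hk _ (ne_self_of_mem_cycles hc) (by omega)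
  rw [Nat.succ_eq_add_one, h1, ← Finset.mul_sum,
    sum_conj_finRotate (by omega) fun ν => (k + m - deg ν).choose m]
  ring

/-! ### Counting primitive words by Möbius inversion -/

section Words

open scoped Fin.CommRing

/-- The cyclic shift of words by one place. -/
def rotateWord {m k : ℕ} (w : Fin (m + 1) → Fin k) : Fin (m + 1) → Fin k := fun j => w (1 + j)

theorem iterate_rotateWord {m k : ℕ} (i : ℕ) (w : Fin (m + 1) → Fin k) :
    rotateWord^[i] w = fun j => w ((i : Fin (m + 1)) + j) := by
  induction i with
  | zero => simp
  | succ i ih =>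
    rw [Function.iterate_succ_apply', ih]
    funext j
    simp [rotateWord, add_assoc]

theorem isPeriodicPt_rotateWord {m k : ℕ} (w : Fin (m + 1) → Fin k) :
    Function.IsPeriodicPt rotateWord (m + 1) w := by
  rw [Function.IsPeriodicPt, Function.IsFixedPt, iterate_rotateWord]
  simp

theorem injective_shiftWord_iff {m k : ℕ} (w : Fin (m + 1) → Fin k) :
    Function.Injective (shiftWord w) ↔ Function.minimalPeriod rotateWord w = m + 1 := by
  have hshift : ∀ i : Fin (m + 1), shiftWord w i = toLex (rotateWord^[i.val] w) := fun i => by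
    rw [iterate_rotateWord, Fin.cast_val_eq_self]; rfl
  have hpos := (isPeriodicPt_rotateWord w).minimalPeriod_pos (Nat.succ_pos m)
  have hle := (isPeriodicPt_rotateWord w).minimalPeriod_le (Nat.succ_pos m)
  constructor
  · intro h
    by_contra hne
    have hlt : Function.minimalPeriod rotateWord w < m + 1 := lt_of_le_of_ne hle hne
    have := @h ⟨_, hlt⟩ 0 (by
      rw [hshift, hshift]
      simp [Function.iterate_minimalPeriod])
    rw [Fin.ext_iff] at this
    exact hpos.ne' this
  · intro h i j hij
    rw [hshift, hshift, toLex_inj] at hij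
    exact Fin.ext (Function.iterate_injOn_Iio_minimalPeriod (by simp [h, Nat.le_of_lt_succ i.isLt])
      (by simp [h, Nat.le_of_lt_succ j.isLt]) hij)

theorem card_isPeriodicPt_rotateWord {m k r : ℕ} (hr : r ∣ m + 1) :
    Nat.card {w : Fin (m + 1) → Fin k // Function.IsPeriodicPt rotateWord r w} = k ^ r := by
  have hr0 : 0 < r := Nat.pos_of_dvd_of_pos hr (Nat.succ_pos m)
  have hrle := Nat.le_of_dvd (Nat.succ_pos m) hr
  have hiff : ∀ w : Fin (m + 1) → Fin k, Function.IsPeriodicPt rotateWord r w ↔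
      ∀ x, w ((r : Fin (m + 1)) + x) = w x := fun w => by
    rw [Function.IsPeriodicPt, Function.IsFixedPt, iterate_rotateWord, funext_iff]
  have hcard : Nat.card (Fin r → Fin k) = k ^ r := by simp
  rw [← hcard]
  refine Nat.card_congr
    { toFun := fun w i => w.1 (i.castLE hrle)
      invFun := fun u => ⟨fun x => u ⟨x.val % r, Nat.mod_lt _ hr0⟩, ?_⟩
      left_inv := ?_
      right_inv := ?_ }
  · rw [hiff]
    intro x
    congr 2
    rw [Fin.val_add, Nat.mod_mod_of_dvd _ hr, Fin.val_natCast, Nat.add_mod,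
      Nat.mod_mod_of_dvd _ hr, Nat.mod_self, zero_add, Nat.mod_mod]
  · rintro ⟨w, hw⟩
    rw [hiff] at hw
    have hper : Function.Periodic (fun a : ℕ => w (a : Fin (m + 1))) r := fun a => by
      simp only [Nat.cast_add]
      rw [add_comm, hw]
    apply Subtype.ext
    funext x
    have := hper.map_mod_nat x.val
    simp only [Fin.cast_val_eq_self] at this
    refine Eq.trans (congrArg w ?_) this
    apply Fin.ext
    rw [Fin.val_natCast, Nat.mod_eq_of_lt ((Nat.mod_lt _ hr0).trans_le hrle)]
    rfl
  · intro u
    funext i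
    exact congrArg u (Fin.ext (Nat.mod_eq_of_lt i.isLt))

end Words

theorem sum_card_minimalPeriod {m k r : ℕ} (hr : r ∣ m + 1) :
    ∑ s ∈ r.divisors,
      Nat.card {w : Fin (m + 1) → Fin k // Function.minimalPeriod rotateWord w = s} = k ^ r := by
  classical
  have hr0 : r ≠ 0 := (Nat.pos_of_dvd_of_pos hr (Nat.succ_pos m)).ne'
  rw [← card_isPeriodicPt_rotateWord hr, Nat.card_eq_fintype_card, Fintype.card_subtype,
    Finset.card_eq_sum_card_fiberwise (f := Function.minimalPeriod rotateWord) (t := r.divisors)]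
  · refine Finset.sum_congr rfl fun s hs => ?_
    rw [Nat.card_eq_fintype_card, Fintype.card_subtype, Finset.filter_filter]
    congr 1
    ext w
    simp only [Finset.mem_filter, Finset.mem_univ, true_and]
    refine ⟨fun h => ⟨?_, h⟩, fun h => h.2⟩
    rw [Function.isPeriodicPt_iff_minimalPeriod_dvd, h]
    exact Nat.dvd_of_mem_divisors hs
  · intro w hw
    simp only [Finset.coe_filter, Finset.mem_univ, true_and, Set.mem_ofPred_eq] at hw
    simpa [hr0] using hw.minimalPeriod_dvd

theorem primitiveCount_eq_sum_moebius (m k : ℕ) :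
    (primitiveCount m k : ℤ) =
      ∑ r ∈ (m + 1).divisors, ArithmeticFunction.moebius ((m + 1) / r) * (k : ℤ) ^ r := by
  have h := (ArithmeticFunction.sum_eq_iff_sum_mul_moebius_eq_on (R := ℤ)
    (f := fun s => (Nat.card {w : Fin (m + 1) → Fin k //
      Function.minimalPeriod rotateWord w = s} : ℤ)) (g := fun r => (k : ℤ) ^ r)
    {r | r ∣ m + 1} fun _ _ => Nat.dvd_trans).1
    (fun r _ hr => by
      have := sum_card_minimalPeriod (k := k) hr
      exact_mod_cast this) (m + 1) (Nat.succ_pos m) dvd_rfl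
  rw [primitiveCount, Nat.card_congr (Equiv.subtypeEquivRight injective_shiftWord_iff), ← h,
    ← Nat.sum_divisorsAntidiagonal' fun a b => ArithmeticFunction.moebius a * (k : ℤ) ^ b]
  simp

/-! ### Identification with Δ_n -/

theorem mul_Delta {n : ℕ} (hn : 2 ≤ n) (k : ℕ) :
    ((k : ℤ) - 1) * Delta n k =
      ∑ r ∈ n.divisors, ArithmeticFunction.moebius (n / r) * (k : ℤ) ^ r := by
  -- For n ≥ 2 this allows k^r to be replaced by k^r - 1 = (k - 1)(1 + ⋯ + k^(r-1)).
  have h0 : ∑ r ∈ n.divisors, ArithmeticFunction.moebius (n / r) = 0 := by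
    rw [Nat.sum_div_divisors n fun r => ArithmeticFunction.moebius r,
      ← ArithmeticFunction.coe_mul_zeta_apply, ArithmeticFunction.moebius_mul_coe_zeta,
      ArithmeticFunction.one_apply_ne (by omega)]
  rw [Delta, Finset.mul_sum, ← sub_zero (∑ r ∈ n.divisors, _ * (k : ℤ) ^ r), ← h0,
    ← Finset.sum_sub_distrib]
  refine Finset.sum_congr rfl fun r _ => ?_
  rw [← mul_sub_one, ← geom_sum_mul]
  ring

open Classical in
/-- Both sides are polynomials in `k`; they agree for `k ≥ 2`, where the factor `k - 1` in the count
of primitive words can be cancelled, hence everywhere. -/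
theorem Delta_eq_sum {m : ℕ} (hm : 2 ≤ m) (k : ℕ) :
    Delta (m + 1) k = ∑ ν with ν ∈ cycles (m + 1), ((k + m - deg ν).choose m : ℤ) := by
  have hlarge : ∀ k, 2 ≤ k → Delta (m + 1) k =
      ∑ ν with ν ∈ cycles (m + 1), ((k + m - deg ν).choose m : ℤ) := by
    intro k hk
    have h1 := primitiveCount_eq_sum_moebius m k
    rw [← mul_Delta (by omega), primitiveCount_eq_sum_cycles hm (by omega)] at h1
    have hk1 : ((k : ℤ) - 1) ≠ 0 := by omega
    apply mul_left_cancel₀ hk1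
    rw [← h1]
    push_cast [Nat.cast_sub (show 1 ≤ k by omega)]
    rfl
  let P : Polynomial ℚ := ∑ r ∈ (m + 1).divisors,
    Polynomial.C (ArithmeticFunction.moebius ((m + 1) / r) : ℚ) *
      ∑ j ∈ Finset.range r, Polynomial.X ^ j
  -- C(y, m) is the falling factorial of y divided by m!; `deg ν ≤ m` keeps the shift `m - deg ν`
  -- exact.
  let Q : Polynomial ℚ := ∑ ν with ν ∈ cycles (m + 1),
    Polynomial.C ((m.factorial : ℚ)⁻¹) *
      (descPochhammer ℚ m).comp (Polynomial.X + Polynomial.C ((m - deg ν : ℕ) : ℚ))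
  have hP : ∀ k : ℕ, P.eval (k : ℚ) = (Delta (m + 1) k : ℚ) := by
    intro k
    simp [P, Delta, Polynomial.eval_finsetSum]
  have hQ : ∀ k : ℕ, Q.eval (k : ℚ) =
      ((∑ ν with ν ∈ cycles (m + 1), ((k + m - deg ν).choose m : ℤ) : ℤ) : ℚ) := by
    intro k
    simp only [Q, Polynomial.eval_finsetSum, Int.cast_sum]
    refine Finset.sum_congr rfl fun ν hν => ?_
    have hd := deg_le (by omega) (Finset.mem_filter.1 hν).2
    have : (k : ℚ) + ((m - deg ν : ℕ) : ℚ) = ((k + m - deg ν : ℕ) : ℚ) := by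
      rw [Nat.add_sub_assoc (by omega)]; push_cast; rfl
    simp only [Polynomial.eval_mul, Polynomial.eval_C, Polynomial.eval_comp, Polynomial.eval_add,
      Polynomial.eval_X]
    rw [this, descPochhammer_eval_eq_descFactorial, Nat.descFactorial_eq_factorial_mul_choose]
    have := Nat.factorial_ne_zero m
    push_cast
    field_simp
  have hPQ : P = Q := by
    apply Polynomial.eq_of_infinite_eval_eq
    refine Set.Infinite.mono ?_ ((Set.Ici_infinite 2).image (Nat.cast_injective (R := ℚ)).injOn)
    rintro _ ⟨k, hk, rfl⟩
    change P.eval _ = Q.eval _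
    rw [hP, hQ, hlarge k hk]
  have := hP k
  rw [hPQ, hQ] at this
  exact_mod_cast this.symm

theorem Delta_eq_sum_N {m : ℕ} (hm : 2 ≤ m) (k : ℕ) :
    Delta (m + 1) k =
      ∑ d ∈ Finset.Icc 1 (m + 1 - 2), (N (m + 1) d : ℤ) * ((k + m - d).choose m : ℤ) := by
  classical
  rw [Delta_eq_sum hm, ← Finset.sum_fiberwise_of_maps_to (g := deg)
    (t := Finset.Icc 1 (m + 1 - 2))]
  · refine Finset.sum_congr rfl fun d _ => ?_
    rw [Finset.filter_filter,
      Finset.sum_congr rfl (g := fun _ => ((k + m - d).choose m : ℤ)) fun ν hν => by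
        rw [(Finset.mem_filter.1 hν).2.2], Finset.sum_const, nsmul_eq_mul, N,
      Set.ncard_eq_toFinset_card', Set.toFinset_ofPred]
  · intro ν hν
    have h := (Finset.mem_filter.1 hν).2
    exact Finset.mem_Icc.2 ⟨deg_pos (Nat.succ_pos m) h, deg_le (by omega) h⟩

/-! ### Generating functions, formal and analytic -/

theorem DeltaSeries_eq {m : ℕ} (hm : 2 ≤ m) :
    DeltaSeries (m + 1) = (G (m + 1) : PowerSeries ℤ) *
      PowerSeries.mk fun i => ((m + i).choose m : ℤ) := by
  ext k
  have hG : (G (m + 1) : PowerSeries ℤ) = ∑ d ∈ Finset.Icc 1 (m + 1 - 2),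
      PowerSeries.C (N (m + 1) d : ℤ) * PowerSeries.X ^ d := by
    simp only [G]
    rw [← Polynomial.coeToPowerSeries.ringHom_apply, map_sum]
    simp only [Polynomial.coeToPowerSeries.ringHom_apply, Polynomial.coe_mul, Polynomial.coe_C,
      Polynomial.coe_pow, Polynomial.coe_X]
  rw [DeltaSeries, PowerSeries.coeff_mk, hG, Finset.sum_mul, map_sum, Delta_eq_sum_N hm]
  split_ifs with hk
  · refine Finset.sum_congr rfl fun d hd => ?_
    rw [Finset.mem_Icc] at hd
    rw [mul_assoc, PowerSeries.coeff_C_mul, PowerSeries.coeff_X_pow_mul']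
    split_ifs with hdk
    · rw [PowerSeries.coeff_mk, show m + (k - d) = k + m - d by omega]
    · rw [Nat.choose_eq_zero_of_lt (show k + m - d < m by omega), Nat.cast_zero]
  · refine (Finset.sum_eq_zero fun d hd => ?_).symm
    rw [Finset.mem_Icc] at hd
    rw [mul_assoc, PowerSeries.coeff_C_mul, PowerSeries.coeff_X_pow_mul', if_neg (by omega),
      mul_zero]

theorem hasSum_choose_sub {m d : ℕ} (hd : 1 ≤ d) (hdm : d ≤ m) {x : ℂ} (hx : ‖x‖ < 1) :
    HasSum (fun i : ℕ => ((i + 1 + m - d).choose m : ℂ) * x ^ (i + 1))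
      (x ^ d * (1 / (1 - x) ^ (m + 1))) := by
  have h := (hasSum_choose_mul_geometric_of_norm_lt_one m hx).mul_left (x ^ d)
  -- Exponents start at 1 here, so x^d has index d - 1; the binomials at smaller indices vanish.
  refine (Function.Injective.hasSum_iff (add_left_injective (d - 1)) fun i hi => ?_).1
    (h.congr_fun fun i => ?_)
  · have hid : i + 1 + m - d < m := by
      by_contra hnot
      exact hi ⟨i + 1 - d, by simp only; omega⟩
    rw [Nat.choose_eq_zero_of_lt hid, Nat.cast_zero, zero_mul]
  · simp only [Function.comp_apply]
    rw [show i + (d - 1) + 1 + m - d = i + m by omega, show i + (d - 1) + 1 = d + i by omega,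
      pow_add]
    ring

theorem hasSum_Delta {m : ℕ} (hm : 2 ≤ m) {x : ℂ} (hx : ‖x‖ < 1) :
    HasSum (fun i : ℕ => (Delta (m + 1) (i + 1) : ℂ) * x ^ (i + 1))
      (Polynomial.aeval x (G (m + 1)) * (1 / (1 - x) ^ (m + 1))) := by
  have h := hasSum_sum (s := Finset.Icc 1 (m + 1 - 2)) fun d hd =>
    (hasSum_choose_sub (m := m) (Finset.mem_Icc.1 hd).1
      ((Finset.mem_Icc.1 hd).2.trans (by omega)) hx).mul_left (N (m + 1) d : ℂ)
  have hval : Polynomial.aeval x (G (m + 1)) * (1 / (1 - x) ^ (m + 1)) =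
      ∑ d ∈ Finset.Icc 1 (m + 1 - 2),
        (N (m + 1) d : ℂ) * (x ^ d * (1 / (1 - x) ^ (m + 1))) := by
    simp only [G]
    rw [map_sum, Finset.sum_mul]
    refine Finset.sum_congr rfl fun d _ => ?_
    simp [mul_assoc]
  rw [hval]
  refine h.congr_fun fun i => ?_
  rw [Delta_eq_sum_N hm]
  push_cast
  rw [Finset.sum_mul]
  exact Finset.sum_congr rfl fun d _ => mul_assoc _ _ _

end CycleDegree

theorem mainTheorem7 (n : ℕ) (hn : 3 ≤ n) :
    (CycleDegree.G n : PowerSeries ℤ) =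
        (1 - PowerSeries.X) ^ n * CycleDegree.DeltaSeries n ∧
    ∀ x : ℂ, ‖x‖ < 1 →
      Summable (fun i : ℕ => ‖(CycleDegree.Delta n (i + 1) : ℂ) * x ^ (i + 1)‖) ∧
      Polynomial.aeval x (CycleDegree.G n) =
        (1 - x) ^ n * ∑' i : ℕ, (CycleDegree.Delta n (i + 1) : ℂ) * x ^ (i + 1) := by
  obtain ⟨m, rfl⟩ : ∃ m, n = m + 1 := ⟨n - 1, by omega⟩
  refine ⟨?_, fun x hx => ?_⟩
  · rw [CycleDegree.DeltaSeries_eq (by omega), mul_left_comm, mul_comm ((1 - PowerSeries.X) ^ _),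
      PowerSeries.mk_add_choose_mul_one_sub_pow_eq_one, mul_one]
  · have h := CycleDegree.hasSum_Delta (m := m) (by omega) hx
    refine ⟨h.summable.norm, ?_⟩
    have hx1 : (1 - x) ^ (m + 1) ≠ 0 := by
      refine pow_ne_zero _ (sub_ne_zero.2 ?_)
      rintro rfl
      simp at hx
    rw [h.tsum_eq, mul_one_div, mul_div_cancel₀ _ hx1]
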